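/- An $\mathsf{MS4}$-algebra is a triple $\mathfrak A=(B,\lozenge,\exists)$ where $B$ is a Boolean algebra, both $\lozenge$ and $\exists$ satisfy the closure-operator identities $f0=0$, $f(a\vee b)=fa\vee fb$, $a\le fa$, $ffa\le fa$, and moreover $\exists\forall a\le\forall a$ and $\exists\lozenge a\le\lozenge\exists a$; here $\square=-\lozenge-$ and $\forall=-\exists-$. Let $\mathbb{MS4}$ be the variety of all $\mathsf{MS4}$-algebras and $\mathbb{S4}_u$ the subvariety defined by $\lozenge a\le\exists a$. For $k\ge 0$ let $$\mathsf{alt}_k^0=\square\forall p_1\vee\square(\forall p_1\to\forall p_2)\vee\dots\vee\square(\forall p_1\wedge\dots\wedge\forall p_k\to\forall p_{k+1})$$ (so $\mathsf{alt}_0^0=\square\forall p_1$), and let $\mathbb{MS4}+(\mathsf{alt}_k^0=1)$ be the variety of $\mathsf{MS4}$-algebras satisfying $\mathsf{alt}_k^0=1$. The dual frame of $\mathfrak A$ has as points the ultrafilters of $B$, with $x\mathrel{R}y$ iff every $a\in x$ with $\square a=a$ belongs to $y$. The depth of $\mathfrak A$ is the supremum (possibly infinite) of the lengths $n$ of chains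 $x_1Rx_2R\cdots Rx_n$ in which $x_jRx_i$ fails whenever $i<j$. A variety $\mathbb V\subseteq\mathbb{MS4}$ (a class closed under homomorphic images, subalgebras and direct products) is of finite depth if for some $n<\omega$ all its members have depth at most $n$; it is locally finite if every finitely generated subalgebra of each of its members is finite. An algebra is subdirectly irreducible if it has a least congruence among those different from the identity. **Theorem.** 1. For every $k\ge1$ and every subvariety $\mathbb V\subseteq\mathbb{MS4}+(\mathsf{alt}_k^0=1)$: $\mathbb V$ is locally finite if and only if $\mathbb V$ is of finite depth. 2. Every $\mathbb{S4}_u$-algebra satisfies $\mathsf{alt}_1^0=1$. 3. For every subvariety $\mathbb V\subseteq\mathbb{S4}_u$: $\mathbb V$ is locally finite if and only if $\mathbb V$ is of finite depth. 4. For every $k\ge0$ and every subdirectly irreducible $\mathsf{MS4}$-algebra $\mathfrak A=(B,\lozenge,\exists)$: $\mathfrak A$ satisfies $\mathsf{alt}_k^0=1$ if and only if the set $B_0=\{a\in B:\exists a=a\}$ has at most $2^k$ elements. -/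

import Mathlib

universe u

/-- An `MS4`-algebra `(B, ◇, ∃)`: a Boolean algebra with an `S4`-possibility operator `dia`
and an `S5`-possibility operator `ex` such that `∃◇a ≤ ◇∃a`. -/
class MS4Algebra (B : Type u) extends BooleanAlgebra B where
  dia : B → B
  ex : B → B
  dia_bot : dia ⊥ = ⊥
  dia_sup : ∀ a b : B, dia (a ⊔ b) = dia a ⊔ dia b
  le_dia : ∀ a : B, a ≤ dia a
  dia_dia_le : ∀ a : B, dia (dia a) ≤ dia a
  ex_bot : ex ⊥ = ⊥
  ex_sup : ∀ a b : B, ex (a ⊔ b) = ex a ⊔ ex b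
  le_ex : ∀ a : B, a ≤ ex a
  ex_ex_le : ∀ a : B, ex (ex a) ≤ ex a
  ex_all_le : ∀ a : B, ex (ex aᶜ)ᶜ ≤ (ex aᶜ)ᶜ
  ex_dia_le : ∀ a : B, ex (dia a) ≤ dia (ex a)

namespace MS4Algebra

/-- `□a = -◇-a`. -/
def box {B : Type u} [MS4Algebra B] (a : B) : B := (dia aᶜ)ᶜ

/-- `∀a = -∃-a`. -/
def all {B : Type u} [MS4Algebra B] (a : B) : B := (ex aᶜ)ᶜ

/-- The universe `B₀` of the subalgebra of `∃`-fixpoints. -/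
def exFixpoints (B : Type u) [MS4Algebra B] : Set B := {a | ex a = a}

/-- Direct products of `MS4`-algebras, with componentwise operations. -/
instance instPi {ι : Type u} {A : ι → Type u} [∀ i, MS4Algebra (A i)] :
    MS4Algebra (∀ i, A i) where
  toBooleanAlgebra := Pi.instBooleanAlgebra
  dia a := fun i => dia (a i)
  ex a := fun i => ex (a i)
  dia_bot := funext fun _ => dia_bot
  dia_sup a b := funext fun i => dia_sup (a i) (b i)
  le_dia a := fun i => le_dia (a i)
  dia_dia_le a := fun i => dia_dia_le (a i)
  ex_bot := funext fun _ => ex_bot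
  ex_sup a b := funext fun i => ex_sup (a i) (b i)
  le_ex a := fun i => le_ex (a i)
  ex_ex_le a := fun i => ex_ex_le (a i)
  ex_all_le a := fun i => ex_all_le (a i)
  ex_dia_le a := fun i => ex_dia_le (a i)

/-- Homomorphisms of `MS4`-algebras (Boolean negation is preserved automatically). -/
structure Hom (A B : Type u) [MS4Algebra A] [MS4Algebra B] extends BoundedLatticeHom A B where
  map_dia : ∀ a : A, toFun (dia a) = dia (toFun a)
  map_ex : ∀ a : A, toFun (ex a) = ex (toFun a)

/-- The universe of the subalgebra generated by `S`: the least set that contains `S`, is a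
Boolean subalgebra, and is closed under `◇` and `∃`. -/
def generated {B : Type u} [MS4Algebra B] (S : Set B) : Set B :=
  {a | ∀ L : BooleanSubalgebra B, S ⊆ L → (∀ b ∈ L, dia b ∈ L) → (∀ b ∈ L, ex b ∈ L) → a ∈ L}

/-- `B` is locally finite: every finitely generated subalgebra of `B` is finite. -/
def IsLocallyFinite (B : Type u) [MS4Algebra B] : Prop :=
  ∀ S : Set B, S.Finite → (generated S).Finite

/-- `r` is a congruence of the `MS4`-algebra `B`. -/
structure IsCongruence {B : Type u} [MS4Algebra B] (r : Setoid B) : Prop where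
  sup : ∀ a a' b b' : B, r a a' → r b b' → r (a ⊔ b) (a' ⊔ b')
  inf : ∀ a a' b b' : B, r a a' → r b b' → r (a ⊓ b) (a' ⊓ b')
  compl : ∀ a a' : B, r a a' → r aᶜ a'ᶜ
  dia : ∀ a a' : B, r a a' → r (dia a) (dia a')
  ex : ∀ a a' : B, r a a' → r (ex a) (ex a')

/-- `B` is subdirectly irreducible: among the congruences of `B` other than the identity
(which is `⊥` in the lattice of equivalence relations) there is a least one. -/
def IsSubdirectlyIrreducible (B : Type u) [MS4Algebra B] : Prop :=
  ∃ r : Setoid B, IsLeast {s : Setoid B | IsCongruence s ∧ s ≠ ⊥} r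

/-- Points of the dual frame of `B`: the ultrafilters of the Boolean algebra `B`. -/
structure DualPoint (B : Type u) [BooleanAlgebra B] where
  carrier : Set B
  top_mem : ⊤ ∈ carrier
  bot_notMem : ⊥ ∉ carrier
  mem_of_le : ∀ a b : B, a ∈ carrier → a ≤ b → b ∈ carrier
  inf_mem : ∀ a b : B, a ∈ carrier → b ∈ carrier → a ⊓ b ∈ carrier
  mem_or_compl_mem : ∀ a : B, a ∈ carrier ∨ aᶜ ∈ carrier

/-- The dual relation `R` of `◇`: `x R y` iff every `□`-fixpoint in `x` belongs to `y`. -/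
def dualRel {B : Type u} [MS4Algebra B] (x y : DualPoint B) : Prop :=
  ∀ a : B, box a = a → a ∈ x.carrier → a ∈ y.carrier

/-- A proper `R`-chain `x₁ R x₂ R ⋯ R xₙ`, that is, one with `¬ xⱼ R xᵢ` for all `i < j`. -/
def IsProperChain {B : Type u} [MS4Algebra B] {n : ℕ} (x : Fin n → DualPoint B) : Prop :=
  (∀ i j : Fin n, (i : ℕ) + 1 = j → dualRel (x i) (x j)) ∧
  (∀ i j : Fin n, i < j → ¬ dualRel (x j) (x i))

/-- The depth of an `MS4`-algebra: the longest length of a proper `R`-chain in its dual frame,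
`⊤` if these lengths are unbounded. -/
noncomputable def depth (B : Type u) [MS4Algebra B] : ℕ∞ :=
  sSup {m : ℕ∞ | ∃ (n : ℕ) (x : Fin n → DualPoint B), IsProperChain x ∧ m = n}

/-- `B` validates `alt_k^0 = ⋁_{i ≤ k} □(∀p₁ ∧ ⋯ ∧ ∀pᵢ → ∀pᵢ₊₁)`. The variables are numbered from
`0` here, and the disjunct for `i = 0`, with the empty conjunction, is `□∀p₁`. -/
def ValidatesAlt (k : ℕ) (B : Type u) [MS4Algebra B] : Prop :=
  ∀ p : ℕ → B,
    (Finset.range (k + 1)).sup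
      (fun i => box ((Finset.range i).inf (fun j => all (p j)) ⇨ all (p i))) = ⊤

/-- `B` is an `S4_u`-algebra: `◇a ≤ ∃a` for all `a`. -/
def IsS4u (B : Type u) [MS4Algebra B] : Prop := ∀ a : B, dia a ≤ ex a

end MS4Algebra

/-- A subvariety of `MS4`: a class of `MS4`-algebras that is closed under homomorphic images,
(isomorphic copies of) subalgebras, and direct products, the empty product included. -/
structure MS4Variety where
  Mem : ∀ (B : Type u) [MS4Algebra B], Prop
  homImage : ∀ (A B : Type u) [MS4Algebra A] [MS4Algebra B] (f : MS4Algebra.Hom A B),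
    Function.Surjective f.toFun → Mem A → Mem B
  subalgebra : ∀ (A B : Type u) [MS4Algebra A] [MS4Algebra B] (f : MS4Algebra.Hom A B),
    Function.Injective f.toFun → Mem B → Mem A
  product : ∀ (ι : Type u) (A : ι → Type u) [∀ i, MS4Algebra (A i)],
    (∀ i, Mem (A i)) → Mem (∀ i, A i)

namespace MS4Variety

/-- Every algebra in the variety is locally finite. -/
def IsLocallyFinite (V : MS4Variety.{u}) : Prop :=
  ∀ (B : Type u) [MS4Algebra B], V.Mem B → MS4Algebra.IsLocallyFinite B

/-- For some `n`, all algebras in the variety have depth at most `n`. -/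
def IsOfFiniteDepth (V : MS4Variety.{u}) : Prop :=
  ∃ n : ℕ, ∀ (B : Type u) [MS4Algebra B], V.Mem B → MS4Algebra.depth B ≤ n

end MS4Variety

/-!
All arguments take place on the dual frame `X`, where an element of the algebra `B` is identified
with the set of the points that it belongs to: the points are the ultrafilters of `B`, preordered by
the dual relation of `◇`, together with the dual relation of `∃` (an equivalence relation,
`exSetoid`) and that of the `S4`-box `□∀` (`masterRel`). The set `Q x` of the points that are
`masterRel`-related to `x` contains `x` and is closed under the other two relations.

*Finite depth implies local finiteness.* If `alt_k^0` holds, then `Q x` meets at most `k` of the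
`∃`-classes, since points of different classes are separated by `∃`-fixpoints; so these classes can
be labelled by `Fin k` (`ValidatesAlt.exists_label`). Given finitely many generators, colour the
points of `Q x` by the generators they contain and by their label. As all chains are bounded by `d`,
a point has a type (`pointType`), taken from a finite set that depends only on `d` and the number of
colours, and having the same type is a bisimulation for the preorder (`exists_le_pointType_eq`);
this is the reason why `S4`-algebras of finite depth are locally finite. If `Q x` and `Q x'` realize
the same types, then points `y` of `Q x` and `y'` of `Q x'` of the same type contain the same
elements of the generated subalgebra: for `◇` this is the bisimulation property, and for `∃` the
labels occur in the types. Hence an element is determined by finitely many bits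
(`isLocallyFinite_of_depth_le`).

*Local finiteness implies finite depth.* On a proper chain of length `m`, take an element `a` that
contains every other point of the chain. The terms `w₀ = 0`, `w_{n+1} = □(w_n ∨ ±a)` with
alternating sign peel off the chain from the top, so `m + 1` of them are different
(`exists_layer_injOn`). If the depth is unbounded in a variety, then a single element of a product
of its members generates an infinite subalgebra.

*Subdirectly irreducible algebras.* If `s` and `t` are different but identified by the least
congruence, then every point that contains their symmetric difference is `masterRel`-related to all
points, because a fixpoint `c ≠ 1` of `□∀` gives the nontrivial congruence `a ∧ c = b ∧ c`. So there
are at most `k` of the `∃`-classes, and an `∃`-fixpoint is a union of them. Conversely,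
`∃`-fixpoints that refute `alt_k^0` cut out `k + 1` disjoint nonzero ones, and these have `2 ^ (k +
1)` joins.
-/

namespace MS4Algebra

/-! ### Ultrafilters -/

namespace DualPoint

variable {B : Type u} [BooleanAlgebra B]

theorem compl_mem_iff (x : DualPoint B) {a : B} : aᶜ ∈ x.carrier ↔ a ∉ x.carrier := by
  refine ⟨fun h h' => x.bot_notMem ?_, fun h => (x.mem_or_compl_mem a).resolve_left h⟩
  simpa using x.inf_mem _ _ h' h

theorem sup_mem_iff (x : DualPoint B) {a b : B} :
    a ⊔ b ∈ x.carrier ↔ a ∈ x.carrier ∨ b ∈ x.carrier := by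
  refine ⟨fun h => ?_, ?_⟩
  · by_contra! hn
    have := x.inf_mem _ _ (x.compl_mem_iff.2 hn.1) (x.compl_mem_iff.2 hn.2)
    rw [← compl_sup] at this
    exact x.compl_mem_iff.1 this h
  · rintro (h | h)
    · exact x.mem_of_le _ _ h le_sup_left
    · exact x.mem_of_le _ _ h le_sup_right

theorem finset_sup_notMem (x : DualPoint B) {ι : Type*} (s : Finset ι) (f : ι → B)
    (h : ∀ i ∈ s, f i ∉ x.carrier) : s.sup f ∉ x.carrier :=
  Finset.sup_induction (p := fun a => a ∉ x.carrier) x.bot_notMem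
    (fun _ ha _ hb hab => (x.sup_mem_iff.1 hab).elim ha hb) h

theorem finset_inf_mem (x : DualPoint B) {ι : Type*} (s : Finset ι) (f : ι → B)
    (h : ∀ i ∈ s, f i ∈ x.carrier) : s.inf f ∈ x.carrier :=
  Finset.inf_induction (p := fun a => a ∈ x.carrier) x.top_mem
    (fun _ ha _ hb => x.inf_mem _ _ ha hb) h

/-- The ultrafilter theorem: a set `F` closed under meets extends to an ultrafilter that contains
`a`, provided that `a` meets all members of `F`. -/
theorem exists_of_inf_ne_bot (F : Set B) (top_mem : ⊤ ∈ F)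
    (inf_mem : ∀ b ∈ F, ∀ c ∈ F, b ⊓ c ∈ F) (a : B) (h : ∀ b ∈ F, b ⊓ a ≠ ⊥) :
    ∃ x : DualPoint B, a ∈ x.carrier ∧ F ⊆ x.carrier := by
  let I : Order.Ideal B :=
    { carrier := {c | ∃ b ∈ F, c ⊓ (b ⊓ a) = ⊥}
      lower' := by
        rintro c d hdc ⟨b, hb, hc⟩
        exact ⟨b, hb, le_bot_iff.1 (hc ▸ inf_le_inf_right _ hdc)⟩
      nonempty' := ⟨⊥, ⊤, top_mem, by simp⟩
      directed' := by
        rintro c ⟨b, hb, hc⟩ d ⟨b', hb', hd⟩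
        refine ⟨c ⊔ d, ⟨b ⊓ b', inf_mem _ hb _ hb', ?_⟩, le_sup_left, le_sup_right⟩
        rw [inf_sup_right, sup_eq_bot_iff]
        refine ⟨le_bot_iff.1 (hc ▸ inf_le_inf_left _ (inf_le_inf_right _ inf_le_left)),
          le_bot_iff.1 (hd ▸ inf_le_inf_left _ (inf_le_inf_right _ inf_le_right))⟩ }
  have hI : Disjoint ((Order.PFilter.principal (⊤ : B) : Order.PFilter B) : Set B) (I : Set B) := by
    rw [Set.disjoint_left]
    rintro c hc ⟨b, hb, hcb⟩
    have : c = ⊤ := top_le_iff.1 hc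
    subst this
    exact h b hb (by simpa using hcb)
  obtain ⟨J, hJ, hIJ, hdisj⟩ := DistribLattice.prime_ideal_of_disjoint_filter_ideal hI
  have htop : (⊤ : B) ∉ J := fun ht => Set.disjoint_left.1 hdisj (le_refl (⊤ : B)) ht
  have hcompl : ∀ c, c ∈ J → cᶜ ∉ J := fun c hc hc' => htop (by
    simpa using Order.Ideal.sup_mem hc hc')
  refine ⟨⟨(J : Set B)ᶜ, htop, fun hb => hb J.bot_mem, fun c d hc hcd hd => hc (J.lower hcd hd),
    fun c d hc hd hcd => (hJ.mem_or_mem hcd).elim hc hd, fun c => ?_⟩, ?_, ?_⟩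
  · by_cases hc : c ∈ J
    · exact Or.inr (hcompl c hc)
    · exact Or.inl hc
  · exact fun ha => hcompl a ha (hIJ ⟨⊤, top_mem, by simp⟩)
  · exact fun b hb hbJ => hcompl b hbJ (hIJ ⟨b, hb, by simp [← inf_assoc]⟩)

theorem exists_mem_of_ne_bot {a : B} (h : a ≠ ⊥) : ∃ x : DualPoint B, a ∈ x.carrier := by
  obtain ⟨x, hx, -⟩ := exists_of_inf_ne_bot {⊤} rfl (by simp) a (by simpa using h)
  exact ⟨x, hx⟩

theorem ext_of_forall_mem_iff {a b : B}
    (h : ∀ x : DualPoint B, a ∈ x.carrier ↔ b ∈ x.carrier) : a = b := by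
  have key : ∀ c d : B, (∀ x : DualPoint B, c ∈ x.carrier → d ∈ x.carrier) → c ≤ d := by
    intro c d hcd
    by_contra hn
    obtain ⟨x, hx⟩ := exists_mem_of_ne_bot (a := c ⊓ dᶜ) fun hb =>
      hn ((le_compl_iff_disjoint_right.2 (disjoint_iff.2 hb)).trans_eq (compl_compl d))
    exact x.compl_mem_iff.1 (x.mem_of_le _ _ hx inf_le_right)
      (hcd x (x.mem_of_le _ _ hx inf_le_left))
  exact le_antisymm (key a b fun x => (h x).1) (key b a fun x => (h x).2)

end DualPoint

/-! ### The operators of an `MS4`-algebra -/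

section Operators

variable {B : Type u} [MS4Algebra B]

theorem dia_mono {a b : B} (h : a ≤ b) : dia a ≤ dia b := by
  rw [← sup_eq_right.2 h, dia_sup]; exact le_sup_left

theorem ex_mono {a b : B} (h : a ≤ b) : ex a ≤ ex b := by
  rw [← sup_eq_right.2 h, ex_sup]; exact le_sup_left

theorem box_mono {a b : B} (h : a ≤ b) : box a ≤ box b :=
  compl_le_compl (dia_mono (compl_le_compl h))

theorem box_le (a : B) : box a ≤ a := compl_le_of_compl_le (le_dia _)

theorem all_le (a : B) : all a ≤ a := compl_le_of_compl_le (le_ex _)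

theorem box_box (a : B) : box (box a) = box a := by
  refine le_antisymm (box_le _) ?_
  unfold box
  rw [compl_compl]
  exact compl_le_compl (dia_dia_le _)

theorem box_top : box (⊤ : B) = ⊤ := by simp [box, dia_bot]

theorem box_inf (a b : B) : box (a ⊓ b) = box a ⊓ box b := by
  simp [box, dia_sup, compl_inf]

theorem ex_all (a : B) : ex (all a) = all a := le_antisymm (ex_all_le a) (le_ex _)

theorem ex_compl_of_ex_eq {c : B} (h : ex c = c) : ex cᶜ = cᶜ := by
  have := ex_all cᶜ
  rwa [all, compl_compl, h] at this

theorem all_eq_of_ex_eq {c : B} (h : ex c = c) : all c = c := by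
  rw [all, ex_compl_of_ex_eq h, compl_compl]

theorem ex_ex (a : B) : ex (ex a) = ex a := le_antisymm (ex_ex_le a) (le_ex _)

theorem ex_inf_of_ex_eq {c d : B} (hc : ex c = c) (hd : ex d = d) : ex (c ⊓ d) = c ⊓ d :=
  le_antisymm (le_inf ((ex_mono inf_le_left).trans hc.le) ((ex_mono inf_le_right).trans hd.le))
    (le_ex _)

theorem ex_sup_of_ex_eq {c d : B} (hc : ex c = c) (hd : ex d = d) : ex (c ⊔ d) = c ⊔ d := by
  rw [ex_sup, hc, hd]

theorem ex_finset_inf_of_ex_eq {ι : Type*} (s : Finset ι) (f : ι → B)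
    (h : ∀ i ∈ s, ex (f i) = f i) : ex (s.inf f) = s.inf f :=
  Finset.inf_induction (p := fun c => ex c = c) (le_antisymm le_top (le_ex _))
    (fun _ hc _ hd => ex_inf_of_ex_eq hc hd) h

theorem ex_finset_sup_of_ex_eq {ι : Type*} (s : Finset ι) (f : ι → B)
    (h : ∀ i ∈ s, ex (f i) = f i) : ex (s.sup f) = s.sup f :=
  Finset.sup_induction (p := fun c => ex c = c) ex_bot
    (fun _ hc _ hd => ex_sup_of_ex_eq hc hd) h

theorem ex_himp_of_ex_eq {c d : B} (hc : ex c = c) (hd : ex d = d) : ex (c ⇨ d) = c ⇨ d := by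
  rw [himp_eq, ex_sup, hd, ex_compl_of_ex_eq hc]

/-- The composite `□∀` is idempotent, hence an `S4`-box. This is where the interaction axiom
`∃◇a ≤ ◇∃a` enters. -/
theorem box_all_box_all (a : B) : box (all (box (all a))) = box (all a) := by
  refine le_antisymm (((box_mono (all_le _)).trans_eq (box_box _))) ?_
  have h : box (all (all a)) ≤ all (box (all a)) := by
    unfold box all
    rw [compl_compl, compl_compl, compl_compl]
    exact compl_le_compl (ex_dia_le _)
  rw [all_eq_of_ex_eq (ex_all a)] at h
  calc box (all a) = box (box (all a)) := (box_box _).symm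
    _ ≤ box (all (box (all a))) := box_mono h

end Operators

/-! ### The dual frame -/

section DualFrame

variable {B : Type u} [MS4Algebra B]

/-- The dual frame with the dual relation of `◇` as its preorder. -/
instance : Preorder (DualPoint B) where
  le := dualRel
  le_refl _ _ _ h := h
  le_trans _ _ _ hxy hyz a ha h := hyz a ha (hxy a ha h)

theorem le_iff_dualRel {x y : DualPoint B} : x ≤ y ↔ dualRel x y := Iff.rfl

theorem box_mem_of_le {x y : DualPoint B} (h : x ≤ y) {a : B} (ha : box a ∈ x.carrier) :
    box a ∈ y.carrier := h _ (box_box a) ha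

theorem mem_of_box_mem {x y : DualPoint B} (h : x ≤ y) {a : B} (ha : box a ∈ x.carrier) :
    a ∈ y.carrier := y.mem_of_le _ _ (box_mem_of_le h ha) (box_le a)

theorem dia_mem_iff {x : DualPoint B} {a : B} :
    dia a ∈ x.carrier ↔ ∃ y, x ≤ y ∧ a ∈ y.carrier := by
  constructor
  · intro h
    obtain ⟨y, hay, hFy⟩ := DualPoint.exists_of_inf_ne_bot {b | box b = b ∧ b ∈ x.carrier}
      ⟨box_top, x.top_mem⟩
      (fun b hb c hc => ⟨by rw [box_inf, hb.1, hc.1], x.inf_mem _ _ hb.2 hc.2⟩) a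
      (fun b hb hba => by
        have h1 : a ≤ bᶜ := le_compl_iff_disjoint_left.2 (disjoint_iff.2 hba)
        have h2 : dia bᶜ = bᶜ := by rw [← compl_compl (dia bᶜ)]; exact congrArg _ hb.1
        exact x.compl_mem_iff.1 (x.mem_of_le _ _ h ((dia_mono h1).trans h2.le)) hb.2)
    exact ⟨y, fun b hb hbx => hFy ⟨hb, hbx⟩, hay⟩
  · rintro ⟨y, hxy, hay⟩
    by_contra hn
    have h1 : box aᶜ ∈ x.carrier := by
      rw [box, compl_compl]; exact x.compl_mem_iff.2 hn
    exact y.compl_mem_iff.1 (mem_of_box_mem hxy h1) hay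

/-- The dual relation of `∃`: two points are equivalent if they have the same `∃`-fixpoints. -/
def exSetoid (B : Type u) [MS4Algebra B] : Setoid (DualPoint B) where
  r x y := ∀ c : B, ex c = c → (c ∈ x.carrier ↔ c ∈ y.carrier)
  iseqv := ⟨fun _ _ _ => Iff.rfl, fun h c hc => (h c hc).symm,
    fun h h' c hc => (h c hc).trans (h' c hc)⟩

theorem ex_mem_iff {x : DualPoint B} {a : B} :
    ex a ∈ x.carrier ↔ ∃ y, exSetoid B x y ∧ a ∈ y.carrier := by
  constructor
  · intro h
    obtain ⟨y, hay, hFy⟩ := DualPoint.exists_of_inf_ne_bot {b | ex b = b ∧ b ∈ x.carrier}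
      ⟨le_antisymm le_top (le_ex _), x.top_mem⟩
      (fun b hb c hc => ⟨ex_inf_of_ex_eq hb.1 hc.1, x.inf_mem _ _ hb.2 hc.2⟩) a
      (fun b hb hba => by
        have h1 : a ≤ bᶜ := le_compl_iff_disjoint_left.2 (disjoint_iff.2 hba)
        exact x.compl_mem_iff.1
          (x.mem_of_le _ _ h ((ex_mono h1).trans (ex_compl_of_ex_eq hb.1).le)) hb.2)
    refine ⟨y, fun c hc => ⟨fun hcx => hFy ⟨hc, hcx⟩, fun hcy => ?_⟩, hay⟩
    by_contra hn
    exact y.compl_mem_iff.1 (hFy ⟨ex_compl_of_ex_eq hc, x.compl_mem_iff.2 hn⟩) hcy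
  · rintro ⟨y, hxy, hay⟩
    exact (hxy _ (ex_ex a)).2 (y.mem_of_le _ _ hay (le_ex a))

/-- The dual relation of `□∀`; `masterRel x y` says that `y` lies in the part of the dual frame
that is generated by `x` under both the dual relation of `◇` and that of `∃`. -/
def masterRel (x y : DualPoint B) : Prop := ∀ a : B, box (all a) ∈ x.carrier → a ∈ y.carrier

theorem masterRel_refl (x : DualPoint B) : masterRel x x := fun _ h =>
  x.mem_of_le _ _ h ((box_le _).trans (all_le _))

theorem masterRel.box_all_mem {x y : DualPoint B} (h : masterRel x y) {a : B}
    (ha : box (all a) ∈ x.carrier) : box (all a) ∈ y.carrier :=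
  h _ (by rwa [box_all_box_all])

theorem masterRel.trans_le {x y z : DualPoint B} (h : masterRel x y) (hyz : y ≤ z) :
    masterRel x z := fun a ha =>
  z.mem_of_le _ _ (mem_of_box_mem hyz (h.box_all_mem ha)) (all_le a)

theorem masterRel.trans_exSetoid {x y z : DualPoint B} (h : masterRel x y)
    (hyz : exSetoid B y z) : masterRel x z := fun a ha =>
  z.mem_of_le _ _ ((hyz _ (ex_all a)).1 (y.mem_of_le _ _ (h.box_all_mem ha) (box_le _))) (all_le a)

/-- Among finitely many points of pairwise different `∃`-classes, each can be singled out by an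
`∃`-fixpoint. -/
theorem exists_ex_eq_separating {ι : Type*} [Finite ι] (y : ι → DualPoint B)
    (hy : ∀ i j, exSetoid B (y i) (y j) → i = j) (i : ι) :
    ∃ c : B, ex c = c ∧ ∀ j, c ∈ (y j).carrier ↔ j = i := by
  classical
  have := Fintype.ofFinite ι
  have h : ∀ j, ∃ c : B, ex c = c ∧ c ∈ (y i).carrier ∧ (j ≠ i → c ∉ (y j).carrier) := by
    intro j
    by_cases hj : j = i
    · exact ⟨⊤, le_antisymm le_top (le_ex _), (y i).top_mem, fun h => absurd hj h⟩
    · have hn : ¬ exSetoid B (y i) (y j) := fun h => hj (hy i j h).symm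
      have : ∃ c : B, ex c = c ∧ ¬ (c ∈ (y i).carrier ↔ c ∈ (y j).carrier) := by
        by_contra! hcon
        exact hn fun c hc => hcon c hc
      obtain ⟨c, hc, hcn⟩ := this
      by_cases hci : c ∈ (y i).carrier
      · exact ⟨c, hc, hci, fun _ hcj => hcn ⟨fun _ => hcj, fun _ => hci⟩⟩
      · refine ⟨cᶜ, ex_compl_of_ex_eq hc, (y i).compl_mem_iff.2 hci, fun _ hcj => ?_⟩
        exact hcn ⟨fun h => absurd h hci, fun h => absurd h ((y j).compl_mem_iff.1 hcj)⟩
  choose c hc hci hcj using h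
  refine ⟨Finset.univ.inf c, ex_finset_inf_of_ex_eq _ _ fun j _ => hc j, fun j => ⟨fun h => ?_, ?_⟩⟩
  · by_contra hj
    exact hcj j hj ((y j).mem_of_le _ _ h (Finset.inf_le (Finset.mem_univ j)))
  · rintro rfl
    exact (y j).finset_inf_mem _ _ fun k _ => hci k

/-- The dual meaning of `alt_k^0`: at most `k` of the `∃`-classes are reached from a point. -/
theorem ValidatesAlt.not_inequivalent {k : ℕ} (hk : ValidatesAlt k B) (x : DualPoint B)
    (y : Fin (k + 1) → DualPoint B) (hxy : ∀ i, masterRel x (y i))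
    (hy : ∀ i j, exSetoid B (y i) (y j) → i = j) : False := by
  choose c hc hcy using exists_ex_eq_separating y hy
  let p : ℕ → B := fun n => if h : n < k + 1 then (c ⟨n, h⟩)ᶜ else ⊤
  have hp : ∀ n, ex (p n) = p n := by
    intro n
    by_cases h : n < k + 1
    · simp only [p, h, dif_pos]; exact ex_compl_of_ex_eq (hc _)
    · simp only [p, h, dif_neg, not_false_iff]; exact le_antisymm le_top (le_ex _)
  have htop := hk p
  refine x.finset_sup_notMem (Finset.range (k + 1)) _ (fun i hi hmem => ?_) (htop ▸ x.top_mem)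
  rw [Finset.mem_range] at hi
  simp only [all_eq_of_ex_eq (hp _)] at hmem
  rw [← all_eq_of_ex_eq (ex_himp_of_ex_eq (ex_finset_inf_of_ex_eq _ _ fun j _ => hp j) (hp i))]
    at hmem
  have h1 := hxy ⟨i, hi⟩ _ hmem
  have h2 : (Finset.range i).inf p ∈ (y ⟨i, hi⟩).carrier := by
    refine DualPoint.finset_inf_mem _ _ _ fun j hj => ?_
    have hji : j < i := Finset.mem_range.1 hj
    have hjk : j < k + 1 := hji.trans hi
    simp only [p, hjk, dif_pos]
    rw [DualPoint.compl_mem_iff, hcy, Fin.mk.injEq]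
    exact hji.ne'
  have h3 : p i ∈ (y ⟨i, hi⟩).carrier :=
    DualPoint.mem_of_le _ _ _ (DualPoint.inf_mem _ _ _ h1 h2) (himp_inf_le)
  simp only [p, hi, dif_pos] at h3
  rw [DualPoint.compl_mem_iff, hcy] at h3
  exact h3 rfl

/-- If `alt_k^0` holds, then the `∃`-classes reached from a point can be labelled by `Fin k`. -/
theorem ValidatesAlt.exists_label {k : ℕ} (hk : ValidatesAlt k B) (x : DualPoint B) :
    ∃ e : DualPoint B → Fin k, ∀ y z, masterRel x y → masterRel x z →
      (e y = e z ↔ exSetoid B y z) := by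
  classical
  let Q := Quotient ((exSetoid B).comap (Subtype.val : {y // masterRel x y} → DualPoint B))
  have hno : ¬ Nonempty (Fin (k + 1) ↪ Q) := by
    rintro ⟨g⟩
    refine hk.not_inequivalent x (fun i => (g i).out.1) (fun i => (g i).out.2) fun i j hij => ?_
    exact g.injective (Quotient.out_equiv_out.1 hij)
  obtain ⟨g⟩ : Nonempty (Q ↪ Fin k) := by
    rcases finite_or_infinite Q with hQ | hQ
    · have := Fintype.ofFinite Q
      rw [Function.Embedding.nonempty_iff_card_le, Fintype.card_fin, ← not_lt]
      intro hlt
      exact hno (Function.Embedding.nonempty_of_card_le (by simpa using hlt))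
    · exact absurd ⟨Fin.valEmbedding.trans (Infinite.natEmbedding Q)⟩ hno
  -- Points that are not reached from `x` get the label of `x`.
  refine ⟨fun y => if h : masterRel x y then g (Quotient.mk _ ⟨y, h⟩)
    else g (Quotient.mk _ ⟨x, masterRel_refl x⟩), fun y z hy hz => ?_⟩
  simp only [hy, hz, dif_pos, g.injective.eq_iff]
  exact Quotient.eq

end DualFrame

/-! ### Types of points of finite rank in coloured preorders -/

section Types

universe v w

/-- The type of a point, up to level `r`, in a preorder with colours in `C`: nothing at level `0`;
at level `r + 1` the colour of the point, the set of the colours in its cluster, and the set of the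
types up to level `r` of its strict successors. -/
def PointType (C : Type v) : ℕ → Type v
  | 0 => PUnit
  | r + 1 => C × Set C × Set (PointType C r)

instance (C : Type v) [Finite C] : ∀ r, Finite (PointType C r)
  | 0 => inferInstanceAs (Finite PUnit)
  | r + 1 =>
    have := instFinitePointType C r
    inferInstanceAs (Finite (C × Set C × Set (PointType C r)))

/-- The type up to level `r` of a point of a preorder with colouring `c`. -/
def pointType {X : Type w} [Preorder X] {C : Type v} (c : X → C) : (r : ℕ) → X → PointType C r
  | 0, _ => PUnit.unit
  | r + 1, x => (c x, c '' {y | x ≤ y ∧ y ≤ x}, pointType c r '' Set.Ioi x)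

/-- `x` has rank at most `r`: there is no strictly increasing chain of `r + 1` points
that starts at `x`. -/
def RankLE {X : Type w} [Preorder X] : ℕ → X → Prop
  | 0, _ => False
  | r + 1, x => ∀ y, x < y → RankLE r y

variable {X : Type w} [Preorder X] {C : Type v} {c c' : X → C}

theorem exists_ltSeries_of_not_rankLE : ∀ (r : ℕ) (x : X), ¬ RankLE r x →
    ∃ p : LTSeries X, p.head = x ∧ p.length = r
  | 0, x, _ => ⟨RelSeries.singleton _ x, rfl, rfl⟩
  | r + 1, x, h => by
    simp only [RankLE, not_forall] at h
    obtain ⟨y, hxy, hy⟩ := h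
    obtain ⟨p, rfl, rfl⟩ := exists_ltSeries_of_not_rankLE r y hy
    exact ⟨p.cons x hxy, by simp, by simp⟩

/-- On points of rank at most `r`, the types up to level `r` determine those up to level `r + 1`. -/
theorem pointType_succ_eq : ∀ (r : ℕ) {c c' : X → C} {x x' : X}, RankLE r x → RankLE r x' →
    pointType c r x = pointType c' r x' → pointType c (r + 1) x = pointType c' (r + 1) x'
  | 0, _, _, _, _, h, _, _ => h.elim
  | r + 1, c, c', x, x', hx, hx', h => by
    have aux : ∀ (d d' : X → C) (z z' : X), RankLE (r + 1) z → RankLE (r + 1) z' →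
        pointType d r '' Set.Ioi z = pointType d' r '' Set.Ioi z' →
        pointType d (r + 1) '' Set.Ioi z ⊆ pointType d' (r + 1) '' Set.Ioi z' := by
      rintro d d' z z' hz hz' hzz _ ⟨w, hw, rfl⟩
      obtain ⟨w', hw', hww⟩ := hzz.subset ⟨w, hw, rfl⟩
      exact ⟨w', hw', pointType_succ_eq r (hz' _ hw') (hz _ hw) hww⟩
    have h3 : pointType c r '' Set.Ioi x = pointType c' r '' Set.Ioi x' :=
      congrArg (fun t : C × Set C × Set (PointType C r) => t.2.2) h
    refine Prod.ext (congrArg (fun t : C × Set C × Set (PointType C r) => t.1) h)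
      (Prod.ext (congrArg (fun t : C × Set C × Set (PointType C r) => t.2.1) h) ?_)
    exact (aux _ _ _ _ hx hx' h3).antisymm (aux _ _ _ _ hx' hx h3.symm)

theorem color_eq_of_pointType_eq : ∀ {r : ℕ} {x x' : X}, RankLE r x →
    pointType c r x = pointType c' r x' → c x = c' x'
  | 0, _, _, hx, _ => hx.elim
  | _ + 1, _, _, _, h => congrArg Prod.fst h

/-- On points of finite rank, having the same type is a bisimulation. -/
theorem exists_le_pointType_eq : ∀ {r : ℕ} {x x' : X}, RankLE r x → RankLE r x' →
    pointType c r x = pointType c' r x' → ∀ {y : X}, x ≤ y →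
    ∃ y', x' ≤ y' ∧ pointType c r y = pointType c' r y'
  | 0, _, _, hx, _, _, _, _ => hx.elim
  | r + 1, x, x', hx, hx', h, y, hxy => by
    have h2 : c '' {y | x ≤ y ∧ y ≤ x} = c' '' {y | x' ≤ y ∧ y ≤ x'} :=
      congrArg (fun t : C × Set C × Set (PointType C r) => t.2.1) h
    have h3 : pointType c r '' Set.Ioi x = pointType c' r '' Set.Ioi x' :=
      congrArg (fun t : C × Set C × Set (PointType C r) => t.2.2) h
    by_cases hyx : y ≤ x
    · -- Points of one cluster have types that differ only in the colour of the point itself.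
      obtain ⟨y', ⟨hy1, hy2⟩, hyy⟩ := h2.subset ⟨y, ⟨hxy, hyx⟩, rfl⟩
      have cluster : ∀ {z w : X}, z ≤ w → w ≤ z →
          {u | z ≤ u ∧ u ≤ z} = {u | w ≤ u ∧ u ≤ w} ∧ Set.Ioi z = Set.Ioi w := by
        intro z w hzw hwz
        constructor
        · ext u
          exact ⟨fun hu => ⟨hwz.trans hu.1, hu.2.trans hzw⟩,
            fun hu => ⟨hzw.trans hu.1, hu.2.trans hwz⟩⟩
        · ext u
          exact ⟨fun hu => hwz.trans_lt hu, fun hu => hzw.trans_lt hu⟩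
      refine ⟨y', hy1, Prod.ext hyy.symm (Prod.ext ?_ ?_)⟩
      · change c '' _ = c' '' _
        rw [← (cluster hxy hyx).1, ← (cluster hy1 hy2).1, h2]
      · change pointType c r '' _ = pointType c' r '' _
        rw [← (cluster hxy hyx).2, ← (cluster hy1 hy2).2, h3]
    · obtain ⟨y', hy', hyy⟩ := h3.subset ⟨y, lt_of_le_not_ge hxy hyx, rfl⟩
      exact ⟨y', hy'.le,
        (pointType_succ_eq r (hx' _ hy') (hx _ (lt_of_le_not_ge hxy hyx)) hyy).symm⟩

end Types

/-! ### Finite depth implies local finiteness -/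

section LocallyFinite

variable {B : Type u} [MS4Algebra B]

theorem isProperChain_of_strictMono {n : ℕ} {x : Fin n → DualPoint B} (hx : StrictMono x) :
    IsProperChain x :=
  ⟨fun _ _ h => (hx (Fin.lt_def.2 (h ▸ Nat.lt_succ_self _))).le, fun _ _ h => (hx h).not_ge⟩

theorem IsProperChain.strictMono {n : ℕ} {x : Fin n → DualPoint B} (hx : IsProperChain x) :
    StrictMono x := by
  cases n with
  | zero => exact fun i => i.elim0
  | succ n =>
    exact Fin.strictMono_iff_lt_succ.2 fun i =>
      lt_of_le_not_ge (hx.1 _ _ (by simp)) (hx.2 _ _ (Fin.castSucc_lt_succ))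

theorem rankLE_of_depth_le {d : ℕ} (h : depth B ≤ d) (x : DualPoint B) : RankLE d x := by
  by_contra hx
  obtain ⟨p, -, hp⟩ := exists_ltSeries_of_not_rankLE d x hx
  have h1 : ((p.length + 1 : ℕ) : ℕ∞) ≤ d :=
    by
    refine le_trans (le_sSup ?_) h
    exact ⟨_, p.toFun, isProperChain_of_strictMono p.strictMono, rfl⟩
  rw [Nat.cast_le] at h1
  omega

/-- With generators `S`, every element of `generated S` is a union of classes of an equivalence
relation on the dual frame that has finitely many classes. -/
theorem isLocallyFinite_of_depth_le {k d : ℕ} (hk : ValidatesAlt k B) (hd : depth B ≤ d) :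
    IsLocallyFinite B := by
  intro S hS
  have : Finite S := hS
  choose e he using fun x : DualPoint B => hk.exists_label x
  -- Relative to a root `x`, a point is coloured by the generators in it and the label of its
  -- `∃`-class.
  let color (x y : DualPoint B) : Set S × Fin k := ({s | s.1 ∈ y.carrier}, e x y)
  let τ (x : DualPoint B) := pointType (color x) d
  let T (x : DualPoint B) := τ x '' {y | masterRel x y}
  have rank : ∀ x : DualPoint B, RankLE d x := rankLE_of_depth_le hd
  -- Elements of the subalgebra cannot separate points of the same type, under any two roots that
  -- realize the same types.
  let L : BooleanSubalgebra B :=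
    { carrier := {a | ∀ x x' y y', T x = T x' → masterRel x y → masterRel x' y' →
        τ x y = τ x' y' → a ∈ y.carrier → a ∈ y'.carrier}
      supClosed' := by
        intro a ha b hb x x' y y' h1 h2 h3 h4 h
        rw [DualPoint.sup_mem_iff] at h ⊢
        exact h.imp (ha _ _ _ _ h1 h2 h3 h4) (hb _ _ _ _ h1 h2 h3 h4)
      infClosed' := by
        intro a ha b hb x x' y y' h1 h2 h3 h4 h
        exact y'.inf_mem _ _ (ha _ _ _ _ h1 h2 h3 h4 (y.mem_of_le _ _ h inf_le_left))
          (hb _ _ _ _ h1 h2 h3 h4 (y.mem_of_le _ _ h inf_le_right))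
      compl_mem' := by
        intro a ha x x' y y' h1 h2 h3 h4 h
        rw [DualPoint.compl_mem_iff] at h ⊢
        exact fun h' => h (ha _ _ _ _ h1.symm h3 h2 h4.symm h')
      bot_mem' := fun _ _ y _ _ _ _ _ h => (y.bot_notMem h).elim }
  have hSL : S ⊆ L := by
    intro s hs x x' y y' h1 h2 h3 h4 h
    have := congrArg Prod.fst (color_eq_of_pointType_eq (rank y) h4)
    exact (this.subset (show (⟨s, hs⟩ : S) ∈ _ from h) :)
  have hdia : ∀ b ∈ L, dia b ∈ L := by
    intro b hb x x' y y' h1 h2 h3 h4 h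
    obtain ⟨z, hyz, hbz⟩ := dia_mem_iff.1 h
    obtain ⟨z', hyz', h5⟩ := exists_le_pointType_eq (rank y) (rank y') h4 hyz
    exact dia_mem_iff.2 ⟨z', hyz', hb _ _ _ _ h1 (h2.trans_le hyz) (h3.trans_le hyz') h5 hbz⟩
  have hex : ∀ b ∈ L, ex b ∈ L := by
    intro b hb x x' y y' h1 h2 h3 h4 h
    obtain ⟨z, hyz, hbz⟩ := ex_mem_iff.1 h
    have hz := h2.trans_exSetoid hyz
    -- The type of `z` is also realized under `x'`, and its label places it in the class of `y'`.
    obtain ⟨z', hz', h5⟩ := h1.subset ⟨z, hz, rfl⟩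
    refine ex_mem_iff.2 ⟨z', (he x' _ _ h3 hz').1 ?_, hb _ _ _ _ h1 hz hz' h5.symm hbz⟩
    have hy := congrArg Prod.snd (color_eq_of_pointType_eq (rank y) h4)
    have hzz := congrArg Prod.snd (color_eq_of_pointType_eq (rank z) h5.symm)
    exact hy.symm.trans (((he x _ _ h2 hz).2 hyz).trans hzz)
  let f (x : DualPoint B) : PointType (Set S × Fin k) d × Set (PointType (Set S × Fin k) d) :=
    (τ x x, T x)
  have key : ∀ a ∈ generated S, ∀ b ∈ generated S,
      f '' {x | a ∈ x.carrier} = f '' {x | b ∈ x.carrier} → ∀ x : DualPoint B,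
      a ∈ x.carrier → b ∈ x.carrier := by
    intro a _ b hb hab x hx
    obtain ⟨x', hx', hf⟩ := hab.subset ⟨x, hx, rfl⟩
    exact hb L hSL hdia hex _ _ _ _ (congrArg Prod.snd hf) (masterRel_refl x')
      (masterRel_refl x) (congrArg Prod.fst hf) hx'
  refine Set.Finite.of_finite_image (f := fun a => f '' {x | a ∈ x.carrier}) (Set.toFinite _) ?_
  exact fun a ha b hb hab => DualPoint.ext_of_forall_mem_iff fun x =>
    ⟨key a ha b hb hab x, key b hb a ha hab.symm x⟩

end LocallyFinite

/-! ### Local finiteness implies finite depth -/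

section FiniteDepth

variable {B : Type u} [MS4Algebra B]

/-- `a` for even `n`, and its complement for odd `n`. -/
def alternate (a : B) (n : ℕ) : B := if Even n then a else aᶜ

/-- The terms `w₀ = 0`, `w₁ = □a`, `w₂ = □(w₁ ∨ -a)`, `w₃ = □(w₂ ∨ a)`, and so on. -/
def layer (a : B) : ℕ → B
  | 0 => ⊥
  | n + 1 => box (layer a n ⊔ alternate a n)

theorem alternate_succ (a : B) (n : ℕ) : alternate a (n + 1) = (alternate a n)ᶜ := by
  by_cases h : Even n <;> simp [alternate, h, Nat.even_add_one]

theorem layer_mem_generated (a : B) (n : ℕ) : layer a n ∈ generated {a} := by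
  intro L hL hdia _
  have ha : a ∈ L := hL rfl
  induction n with
  | zero => exact L.bot_mem
  | succ n ih =>
    have h : alternate a n ∈ L := by
      unfold alternate; split_ifs
      exacts [ha, BooleanSubalgebra.compl_mem ha]
    exact BooleanSubalgebra.compl_mem
      (hdia _ (BooleanSubalgebra.compl_mem (BooleanSubalgebra.sup_mem ih h)))

/-- Along a strictly decreasing chain of `m` points, the elements `v i` are open, and `v i`
belongs to exactly the first `i` points. Only the two extreme cases are stated; the others follow by
monotonicity. -/
theorem exists_open_separating {m : ℕ} (y : ℕ → DualPoint B)
    (hy : ∀ s t, s < t → t < m → y t < y s) :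
    ∃ v : ℕ → B, v 0 = ⊥ ∧ Monotone v ∧ (∀ i, v i ≤ box (v i)) ∧
      (∀ t < m, v (t + 1) ∈ (y t).carrier) ∧ (∀ t < m, v t ∉ (y t).carrier) := by
  have h : ∀ j, ∃ u : B, box u = u ∧
      (j < m → u ∈ (y j).carrier ∧ ∀ t, j < t → t < m → u ∉ (y t).carrier) := by
    intro j
    by_cases hj : j + 1 < m
    · have hn : ¬ y j ≤ y (j + 1) := (hy j (j + 1) (Nat.lt_succ_self j) hj).not_ge
      rw [le_iff_dualRel] at hn
      unfold dualRel at hn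
      push Not at hn
      obtain ⟨u, hu, huj, hun⟩ := hn
      refine ⟨u, hu, fun _ => ⟨huj, fun t hjt htm hut => hun ?_⟩⟩
      rcases (Nat.succ_le_of_lt hjt).eq_or_lt with rfl | h
      · exact hut
      · exact (hy _ t h htm).le u hu hut
    · exact ⟨⊤, box_top, fun hjm => ⟨(y j).top_mem, fun t h1 h2 => by omega⟩⟩
  choose u hu huy using h
  refine ⟨fun i => (Finset.range i).sup u, rfl,
    fun i j hij => Finset.sup_mono (Finset.range_mono hij), fun i => Finset.sup_le fun j hj => ?_,
    fun t ht => ?_, fun t ht => ?_⟩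
  · rw [← hu j]
    exact box_mono (Finset.le_sup hj)
  · exact (y t).mem_of_le _ _ (huy t ht).1 (Finset.le_sup (Finset.self_mem_range_succ t))
  · refine (y t).finset_sup_notMem _ _ fun j hj => ?_
    have hjt := Finset.mem_range.1 hj
    exact (huy j (hjt.trans ht)).2 t hjt ht

/-- For an increasing sequence `v`, the join `a` of the differences `v (j + 1) - v j` over the even
`j` makes these differences lie alternately in `a` and in its complement. -/
theorem exists_alternating (v : ℕ → B) (hv : Monotone v) (m : ℕ) :
    ∃ a : B, ∀ i < m, v (i + 1) ≤ v i ⊔ alternate a i := by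
  refine ⟨((Finset.range m).filter Even).sup fun j => v (j + 1) ⊓ (v j)ᶜ, fun i hi => ?_⟩
  by_cases he : Even i
  · have h : v (i + 1) ⊓ (v i)ᶜ ≤
        ((Finset.range m).filter Even).sup fun j => v (j + 1) ⊓ (v j)ᶜ :=
      Finset.le_sup (f := fun j => v (j + 1) ⊓ (v j)ᶜ) (by simp [hi, he])
    simp only [alternate, he, if_true]
    refine le_trans ?_ (sup_le_sup_left h _)
    rw [sup_inf_left, sup_compl_eq_top, inf_top_eq]
    exact le_sup_right
  · simp only [alternate, he, if_false]
    rw [← himp_eq, le_himp_iff, Finset.sup_inf_distrib_left]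
    refine Finset.sup_le fun j hj => ?_
    have hje : Even j := (Finset.mem_filter.1 hj).2
    rcases lt_trichotomy j i with h | rfl | h
    · exact inf_le_right.trans (inf_le_left.trans (hv h))
    · exact absurd hje he
    · -- Here `v (i + 1) ≤ v j`, so the meet is `⊥`.
      calc v (i + 1) ⊓ (v (j + 1) ⊓ (v j)ᶜ) ≤ v j ⊓ (v j)ᶜ := inf_le_inf (hv h) inf_le_right
        _ ≤ v i := by simp

/-- A proper chain of length `m` makes `m + 1` of the terms `layer a` take different values at
a suitable element: `layer a i` belongs to exactly the last `i` points of the chain. -/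
theorem exists_layer_injOn {m : ℕ} {x : Fin m → DualPoint B} (hx : IsProperChain x) :
    ∃ a : B, ∀ i j, i < j → j ≤ m → layer a i ≠ layer a j := by
  rcases Nat.eq_zero_or_pos m with rfl | hm
  · exact ⟨⊥, fun i j h1 h2 => by omega⟩
  let y : ℕ → DualPoint B := fun t => x ⟨m - 1 - t, by omega⟩
  have hy : ∀ s t, s < t → t < m → y t < y s := fun s t hst ht =>
    hx.strictMono (Fin.mk_lt_mk.2 (by omega))
  obtain ⟨v, hv0, hvm, hvb, hv1, hv2⟩ := exists_open_separating y hy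
  obtain ⟨a, ha⟩ := exists_alternating v hvm m
  have hle : ∀ i ≤ m, v i ≤ layer a i := by
    intro i
    induction i with
    | zero => exact fun _ => hv0.le
    | succ i ih =>
      intro hi
      exact (hvb _).trans (box_mono ((ha i hi).trans (sup_le_sup_right (ih (by omega)) _)))
  have halt : ∀ t < m, alternate a t ∈ (y t).carrier := fun t ht =>
    ((y t).sup_mem_iff.1 ((y t).mem_of_le _ _ (hv1 t ht) (ha t ht))).resolve_left (hv2 t ht)
  have hnot : ∀ i t, i ≤ t → t < m → layer a i ∉ (y t).carrier := by
    intro i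
    induction i with
    | zero => exact fun t _ _ => (y t).bot_notMem
    | succ i ih =>
      intro t hit ht hmem
      have hle : y t ≤ y (i + 1) := by
        rcases hit.eq_or_lt with rfl | h
        · exact le_rfl
        · exact (hy _ _ h ht).le
      rcases (y (i + 1)).sup_mem_iff.1 (mem_of_box_mem hle hmem) with h | h
      · exact ih (i + 1) (by omega) (by omega) h
      · have := halt (i + 1) (by omega)
        rw [alternate_succ, DualPoint.compl_mem_iff] at this
        exact this h
  refine ⟨a, fun i j hij hj heq => hnot i i le_rfl (by omega) ?_⟩
  rw [heq]
  exact (y i).mem_of_le _ _ (hv1 i (by omega)) ((hvm hij).trans (hle j hj))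

theorem layer_pi {ι : Type u} {A : ι → Type u} [∀ i, MS4Algebra (A i)] (a : ∀ i, A i) (n : ℕ)
    (i : ι) : layer a n i = layer (a i) n := by
  induction n with
  | zero => rfl
  | succ n ih =>
    have h : alternate a n i = alternate (a i) n := by
      unfold alternate; split_ifs <;> rfl
    rw [layer, layer, ← ih, ← h]
    rfl

end FiniteDepth

end MS4Algebra

namespace MS4Variety

open MS4Algebra

/-- If the depth were unbounded, an element of a product of members of larger and larger depth would
generate an infinite subalgebra. -/
theorem IsLocallyFinite.isOfFiniteDepth {V : MS4Variety.{u}} (hV : V.IsLocallyFinite) :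
    V.IsOfFiniteDepth := by
  by_contra hn
  have h : ∀ n : ULift.{u} ℕ, ∃ (B : Type u) (_ : MS4Algebra B), V.Mem B ∧
      ∃ a : B, ∀ i j, i < j → j ≤ n.down → layer a i ≠ layer a j := by
    intro n
    unfold IsOfFiniteDepth at hn
    push Not at hn
    obtain ⟨B, _, hB, hd⟩ := hn n.down
    obtain ⟨_, ⟨m, x, hx, rfl⟩, hm⟩ := lt_sSup_iff.1 hd
    obtain ⟨a, ha⟩ := exists_layer_injOn hx
    exact ⟨B, _, hB, a, fun i j hij hj => ha i j hij (hj.trans (Nat.cast_lt.1 hm).le)⟩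
  choose A inst hA a ha using h
  have hinj : Function.Injective (layer a) := by
    have hne : ∀ i j, i < j → layer a i ≠ layer a j := fun i j hij heq =>
      ha ⟨j⟩ i j hij le_rfl (by rw [← layer_pi, ← layer_pi, heq])
    intro i j heq
    by_contra hij
    exact (Ne.lt_or_gt hij).elim (fun h => hne i j h heq) fun h => hne j i h heq.symm
  exact Set.infinite_of_injective_forall_mem hinj (layer_mem_generated a)
    (hV _ (V.product _ A hA) {a} (Set.finite_singleton a))

theorem isLocallyFinite_iff_of_validatesAlt {k : ℕ} {V : MS4Variety.{u}}
    (hV : ∀ (B : Type u) [MS4Algebra B], V.Mem B → ValidatesAlt k B) :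
    V.IsLocallyFinite ↔ V.IsOfFiniteDepth :=
  ⟨IsLocallyFinite.isOfFiniteDepth, fun ⟨_, hd⟩ B _ hB =>
    isLocallyFinite_of_depth_le (hV B hB) (hd B hB)⟩

end MS4Variety

namespace MS4Algebra

/-! ### `S4_u`-algebras -/

section S4u

variable {B : Type u} [MS4Algebra B]

theorem IsS4u.box_eq_of_ex_eq (h : IsS4u B) {c : B} (hc : ex c = c) : box c = c := by
  refine le_antisymm (box_le c) (le_compl_comm.1 ?_)
  exact (h _).trans (ex_compl_of_ex_eq hc).le

theorem IsS4u.validatesAlt_one (h : IsS4u B) : ValidatesAlt 1 B := by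
  intro p
  have h0 := ex_all (p 0)
  have h1 := h.box_eq_of_ex_eq (ex_himp_of_ex_eq h0 (ex_all (p 1)))
  simp only [Finset.range_add_one, Finset.range_zero, Finset.sup_insert, Finset.inf_empty, insert_empty_eq,
    Finset.sup_singleton,
    Finset.inf_singleton, top_himp, h.box_eq_of_ex_eq h0, h1]
  rw [himp_eq, sup_assoc, compl_sup_eq_top, sup_top_eq]

end S4u

/-! ### Subdirectly irreducible algebras -/

section SubdirectlyIrreducible

variable {B : Type u} [MS4Algebra B]

theorem all_eq_and_box_eq {c : B} (h : box (all c) = c) : all c = c ∧ box c = c := by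
  refine ⟨le_antisymm (all_le c) ?_, by rw [← h, box_box]⟩
  conv_lhs => rw [← h]
  exact box_le _

/-- If `c` is a fixpoint of `□∀`, then `a ∧ c = b ∧ c` defines a congruence. -/
theorem isCongruence_ker_inf {c : B} (h : box (all c) = c) :
    IsCongruence (Setoid.ker fun a : B => a ⊓ c) := by
  have aux : ∀ f : B → B, (∀ a b, f (a ⊔ b) = f a ⊔ f b) → f cᶜ ≤ cᶜ →
      ∀ a a' : B, a ⊓ c = a' ⊓ c → f a ⊓ c = f a' ⊓ c := by
    intro f hf hc
    have key : ∀ a, f a ⊓ c = f (a ⊓ c) ⊓ c := by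
      intro a
      have hmono : ∀ s t, s ≤ t → f s ≤ f t := fun s t hst => by
        rw [← sup_eq_right.2 hst, hf]; exact le_sup_left
      have h1 : f a ≤ f (a ⊓ c) ⊔ cᶜ := by
        conv_lhs => rw [← sup_inf_inf_compl (x := a) (y := c), hf]
        exact sup_le_sup_left ((hmono _ _ inf_le_right).trans hc) _
      refine le_antisymm ?_ (inf_le_inf_right _ (hmono _ _ inf_le_left))
      refine le_inf ((inf_le_inf_right c h1).trans ?_) inf_le_right
      rw [inf_sup_right, compl_inf_self, sup_bot_eq]
      exact inf_le_left
    intro a a' haa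
    rw [key a, key a', haa]
  obtain ⟨hall, hbox⟩ := all_eq_and_box_eq h
  refine ⟨?_, ?_, ?_, aux dia dia_sup (le_compl_comm.1 hbox.ge),
    aux ex ex_sup (le_compl_comm.1 hall.ge)⟩
  · intro a a' b b' h1 h2
    simp only [Setoid.ker_def, inf_sup_right] at h1 h2 ⊢
    rw [h1, h2]
  · intro a a' b b' h1 h2
    simp only [Setoid.ker_def] at h1 h2 ⊢
    rw [inf_inf_distrib_right, h1, h2, ← inf_inf_distrib_right]
  · intro a a' h1
    simp only [Setoid.ker_def] at h1 ⊢
    have hcompl : ∀ s : B, sᶜ ⊓ c = (s ⊓ c)ᶜ ⊓ c := fun s => by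
      rw [compl_inf, inf_sup_right, compl_inf_self, sup_bot_eq]
    rw [hcompl a, hcompl a', h1]

/-- The dual frame of a subdirectly irreducible algebra is generated by one point. -/
theorem IsSubdirectlyIrreducible.exists_root (h : IsSubdirectlyIrreducible B) :
    ∃ x : DualPoint B, ∀ y, masterRel x y := by
  obtain ⟨r, ⟨-, hr⟩, hleast⟩ := h
  obtain ⟨s, t, hst, hne⟩ : ∃ s t, r s t ∧ s ≠ t := by
    by_contra! hcon
    exact hr (le_bot_iff.1 fun s t hst => hcon s t hst)
  -- Any point that contains the symmetric difference of a pair of the least congruence is a root.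
  obtain ⟨x, hx⟩ := DualPoint.exists_mem_of_ne_bot (a := symmDiff s t)
    fun h => hne (symmDiff_eq_bot.1 h)
  refine ⟨x, fun y a ha => ?_⟩
  suffices box (all a) = ⊤ from
    y.mem_of_le _ _ (this ▸ y.top_mem) ((box_le _).trans (all_le a))
  by_contra htop
  have hker := hleast ⟨isCongruence_ker_inf (box_all_box_all a), fun hbot => htop ?_⟩ hst
  · have h1 : symmDiff s t ⊓ box (all a) = ⊥ := by
      rw [inf_symmDiff_distrib_right, symmDiff_eq_bot]; exact hker
    exact x.bot_notMem (h1 ▸ x.inf_mem _ _ hx ha)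
  · have h1 : (Setoid.ker fun b : B => b ⊓ box (all a)) (box (all a)) ⊤ := by
      simp [Setoid.ker_def]
    rw [hbot] at h1
    exact h1

theorem ValidatesAlt.encard_exFixpoints_le {k : ℕ} (hk : ValidatesAlt k B)
    (h : IsSubdirectlyIrreducible B) : (exFixpoints B).encard ≤ 2 ^ k := by
  obtain ⟨x, hx⟩ := h.exists_root
  obtain ⟨e, he⟩ := hk.exists_label x
  have hinj : Set.InjOn (fun c : B => e '' {y | c ∈ y.carrier}) (exFixpoints B) := by
    have key : ∀ c ∈ exFixpoints B, ∀ d ∈ exFixpoints B,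
        e '' {y | c ∈ y.carrier} = e '' {y | d ∈ y.carrier} → ∀ y : DualPoint B,
        c ∈ y.carrier → d ∈ y.carrier := by
      intro c _ d hd hcd y hy
      obtain ⟨z, hz, hzy⟩ := hcd.subset ⟨y, hy, rfl⟩
      exact ((he z y (hx z) (hx y)).1 hzy d hd).1 hz
    exact fun c hc d hd hcd => DualPoint.ext_of_forall_mem_iff fun y =>
      ⟨key c hc d hd hcd y, key d hd c hc hcd.symm y⟩
  calc (exFixpoints B).encard
      = ((fun c : B => e '' {y | c ∈ y.carrier}) '' exFixpoints B).encard := hinj.encard_image.symm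
    _ ≤ (Set.univ : Set (Set (Fin k))).encard := Set.encard_le_encard (Set.subset_univ _)
    _ = 2 ^ k := by simp [Set.encard_univ, ENat.card_eq_coe_fintype_card]

/-- If `alt_k^0` fails, then the `∃`-fixpoints that refute it cut out `k + 1` disjoint nonzero
`∃`-fixpoints, whose joins are `2 ^ (k + 1)` different `∃`-fixpoints. -/
theorem validatesAlt_of_encard_exFixpoints_le {k : ℕ} (h : (exFixpoints B).encard ≤ 2 ^ k) :
    ValidatesAlt k B := by
  intro p
  by_contra hn
  let c : ℕ → B := fun i => all (p i)
  let g : ℕ → B := fun i => (Finset.range i).inf c ⊓ (c i)ᶜ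
  have hc : ∀ i, ex (c i) = c i := fun i => ex_all _
  have hg : ∀ i, ex (g i) = g i := fun i =>
    ex_inf_of_ex_eq (ex_finset_inf_of_ex_eq _ _ fun j _ => hc j) (ex_compl_of_ex_eq (hc i))
  have hne : ∀ i ∈ Finset.range (k + 1), g i ≠ ⊥ := by
    intro i hi hbot
    refine hn (top_le_iff.1 (le_trans ?_ (Finset.le_sup hi)))
    have h1 : (Finset.range i).inf c ≤ c i :=
      (le_compl_iff_disjoint_right.2 (disjoint_iff.2 hbot)).trans_eq (compl_compl _)
    rw [himp_eq_top_iff.2 h1, box_top]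
  have hlt : ∀ i j, i < j → Disjoint (g i) (g j) := by
    intro i j hij
    refine disjoint_compl_left.mono inf_le_right (inf_le_left.trans ?_)
    exact Finset.inf_le (Finset.mem_range.2 hij)
  have hdisj : ∀ i j, i ≠ j → Disjoint (g i) (g j) := fun i j hij =>
    hij.lt_or_gt.elim (hlt i j) fun h => (hlt j i h).symm
  have hsub : ∀ s ∈ (Finset.range (k + 1)).powerset, ∀ t ∈ (Finset.range (k + 1)).powerset,
      s.sup g = t.sup g → s ⊆ t := by
    intro s hs t _ hst i hi
    by_contra hit
    have h1 : Disjoint (g i) (t.sup g) := Finset.disjoint_sup_right.2 fun j hj =>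
      hdisj i j fun hij => hit (hij ▸ hj)
    exact hne i (Finset.mem_powerset.1 hs hi)
      (h1.eq_bot_of_le ((Finset.le_sup hi).trans hst.le))
  have hinj : Set.InjOn (fun s : Finset ℕ => s.sup g)
      ((Finset.range (k + 1)).powerset : Set (Finset ℕ)) := fun s hs t ht hst =>
    (hsub s hs t ht hst).antisymm (hsub t ht s hs hst.symm)
  have hcard : ((2 ^ (k + 1) : ℕ) : ℕ∞) ≤ ((2 ^ k : ℕ) : ℕ∞) := by
    calc ((2 ^ (k + 1) : ℕ) : ℕ∞)
        = ((Finset.range (k + 1)).powerset : Set (Finset ℕ)).encard := by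
          rw [Set.encard_coe_eq_coe_finsetCard, Finset.card_powerset, Finset.card_range]
      _ = ((fun s : Finset ℕ => s.sup g) '' (Finset.range (k + 1)).powerset).encard :=
          hinj.encard_image.symm
      _ ≤ (exFixpoints B).encard := by
          refine Set.encard_le_encard ?_
          rintro _ ⟨s, -, rfl⟩
          exact ex_finset_sup_of_ex_eq _ _ fun i _ => hg i
      _ ≤ ((2 ^ k : ℕ) : ℕ∞) := by exact_mod_cast h
  rw [Nat.cast_le, Nat.pow_le_pow_iff_right (by norm_num)] at hcard
  omega

end SubdirectlyIrreducible

end MS4Algebra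

theorem mainTheorem4 :
    -- subvarieties of `MS4 + (alt_k^0 = 1)`
    (∀ k : ℕ, 1 ≤ k → ∀ V : MS4Variety.{u},
      (∀ (B : Type u) [MS4Algebra B], V.Mem B → MS4Algebra.ValidatesAlt k B) →
      (V.IsLocallyFinite ↔ V.IsOfFiniteDepth)) ∧
    -- `S4_u` satisfies `alt_1^0`
    (∀ (B : Type u) [MS4Algebra B], MS4Algebra.IsS4u B → MS4Algebra.ValidatesAlt 1 B) ∧
    -- subvarieties of `S4_u`
    (∀ V : MS4Variety.{u},
      (∀ (B : Type u) [MS4Algebra B], V.Mem B → MS4Algebra.IsS4u B) →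
      (V.IsLocallyFinite ↔ V.IsOfFiniteDepth)) ∧
    -- the size of the algebra of `∃`-fixpoints
    (∀ (k : ℕ) (B : Type u) [MS4Algebra B], MS4Algebra.IsSubdirectlyIrreducible B →
      (MS4Algebra.ValidatesAlt k B ↔ (MS4Algebra.exFixpoints B).encard ≤ 2 ^ k)) :=
  ⟨fun _ _ _ hV => MS4Variety.isLocallyFinite_iff_of_validatesAlt hV,
    fun _ _ h => h.validatesAlt_one,
    fun _ hV => MS4Variety.isLocallyFinite_iff_of_validatesAlt fun B _ hB =>
      (hV B hB).validatesAlt_one,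
    fun _ _ _ h => ⟨fun hk => hk.encard_exFixpoints_le h,
      MS4Algebra.validatesAlt_of_encard_exFixpoints_le⟩⟩
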